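/- Let $E$ be a field of characteristic zero and let $\mathfrak g$ be a finite-dimensional simple Lie algebra over $E$, where simple means that $\mathfrak g\neq 0$ and the only ideals of $\mathfrak g$ are $0$ and $\mathfrak g$ (the one-dimensional Lie algebra is allowed). Let $\sigma\neq 1$ be an automorphism of the Lie algebra $\mathfrak g$ over $E$ with $\sigma^2=1$, and let $\mathfrak k=\{x\in\mathfrak g:\sigma(x)=x\}$ be its fixed-point subalgebra. Assume that $\mathfrak k$ is semisimple (the zero Lie algebra counts as semisimple). Then every $E$-linear subspace $V$ of $\mathfrak g$ with $\mathfrak k\subseteq V$ and $[\mathfrak k,V]\subseteq V$ is equal to $\mathfrak k$ or to $\mathfrak g$. In particular, $\mathfrak k$ is a maximal proper subalgebra of $\mathfrak g$: $\mathfrak k\neq\mathfrak g$, and every Lie subalgebra of $\mathfrak g$ that strictly contains $\mathfrak k$ equals $\mathfrak g$. -/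

import Mathlib

/-- The fixed-point subalgebra `{x | σ x = x}` of an automorphism `σ` of a Lie algebra. -/
def lieFixedPoints {E : Type*} {g : Type*} [CommRing E] [LieRing g] [LieAlgebra E g]
    (σ : g ≃ₗ⁅E⁆ g) : LieSubalgebra E g where
  carrier := {x | σ x = x}
  add_mem' := by
    intro a b ha hb
    change σ a = a at ha
    change σ b = b at hb
    change σ (a + b) = a + b
    rw [map_add, ha, hb]
  zero_mem' := by simp
  smul_mem' := by
    intro c x hx
    change σ x = x at hx
    change σ (c • x) = c • x
    rw [map_smul, hx]
  lie_mem' := by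
    intro a b ha hb
    change σ a = a at ha
    change σ b = b at hb
    change σ ⁅a, b⁆ = ⁅a, b⁆
    rw [LieEquiv.map_lie, ha, hb]

/-!
Write `k` for the fixed points of `σ` and `p` for its `-1`-eigenspace, so that `g = k ⊕ p` with
`⁅k, p⁆ ⊆ p` and `⁅p, p⁆ ⊆ k`. If `g` is abelian, every subspace is an ideal and there is nothing to
do. Otherwise Cartan's criterion makes the Killing form `B` of `g` nondegenerate, and `k` is
orthogonal to `p`. Let `V ⊇ k` be a `k`-stable subspace and let `N` be its orthogonal complement; it
is a `k`-stable subspace of `p`.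

* `⁅V ∩ p, N⁆ = 0`, because this bracket lies in `k`, and is orthogonal to `k` by invariance
  (`lie_eq_zero_of_mem_of_orthogonal`).
* The key point is that `V ∩ N = 0` (`eq_zero_of_mem_of_mem_orthogonal`). For `x ∈ V ∩ N` and
  `y ∈ p`, one has `B x y = tr ((1 - σ) ∘ ad x ∘ ad y)`: the trace of `σ ∘ ad x ∘ ad y` vanishes,
  because `σ` anticommutes with `ad x` and `⁅x, y⁆` lies in `k = ⁅k, k⁆`. The operator
  `(1 - σ) ∘ ad x ∘ ad y` has its range in `V ∩ N`, where it acts as `2 • ad ⁅x, y⁆` by the first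
  point, so that its trace is zero, again because `k = ⁅k, k⁆`. Hence `x` is orthogonal to `g`. This
  is the only use of the semisimplicity of `k`, and it needs no complete reducibility.
* Therefore `g = V ⊕ N`, and by the first point `N + ⁅N, N⁆` is an ideal of `g` orthogonal to `V ∩ p`
  (`exists_lieIdeal_of_orthogonal`). By simplicity it is `0`, and then `N = 0` and `V = g`, or it is
  `g`, and then `V ∩ p = 0` and `V = k`.
-/

/-! ### Semisimple Lie algebras are perfect -/

section Perfect

variable {E L : Type*} [Field E] [LieRing L] [LieAlgebra E L]

/-- A semisimple Lie algebra is perfect, because each of its minimal ideals is. -/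
theorem LieAlgebra.IsSemisimple.lie_top_top [LieAlgebra.IsSemisimple E L] :
    ⁅(⊤ : LieIdeal E L), (⊤ : LieIdeal E L)⁆ = ⊤ := by
  rw [eq_top_iff, ← LieAlgebra.IsSemisimple.sSup_atoms_eq_top (R := E) (L := L)]
  refine sSup_le fun I hI => ?_
  rw [← lie_eq_self_of_isAtom_of_nonabelian I hI
    (LieAlgebra.IsSemisimple.non_abelian_of_isAtom I hI)]
  have h : I ≤ sSup {I : LieIdeal E L | IsAtom I} := le_sSup hI
  exact LieSubmodule.mono_lie h h

theorem LieAlgebra.IsSemisimple.linearMap_eq_zero [LieAlgebra.IsSemisimple E L]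
    (f : L →ₗ[E] E) (hf : ∀ a b : L, f ⁅a, b⁆ = 0) (x : L) : f x = 0 := by
  have hx : x ∈ (⁅(⊤ : LieIdeal E L), (⊤ : LieIdeal E L)⁆ : LieIdeal E L) := by
    rw [LieAlgebra.IsSemisimple.lie_top_top]; exact LieSubmodule.mem_top x
  rw [← LieSubmodule.mem_toSubmodule, LieSubmodule.lieIdeal_oper_eq_linear_span'] at hx
  induction hx using Submodule.span_induction with
  | mem z hz => obtain ⟨a, -, b, -, rfl⟩ := hz; exact hf a b
  | zero => exact map_zero f
  | add a b _ _ ha hb => rw [map_add, ha, hb, add_zero]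
  | smul c a _ ha => rw [map_smul, ha, smul_zero]

end Perfect

theorem ad_lie_eq_mul_sub_mul {R L : Type*} [CommRing R] [LieRing L] [LieAlgebra R L] (x y : L) :
    LieAlgebra.ad R L ⁅x, y⁆ =
      LieAlgebra.ad R L x * LieAlgebra.ad R L y - LieAlgebra.ad R L y * LieAlgebra.ad R L x :=
  LinearMap.ext fun z => lie_lie x y z

/-! ### Involutions and the Killing form -/

section Involution

variable {E : Type*} {g : Type*} [Field E] [LieRing g] [LieAlgebra E g] {σ : g ≃ₗ⁅E⁆ g}

theorem mem_lieFixedPoints {x : g} : x ∈ lieFixedPoints σ ↔ σ x = x := Iff.rfl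

/-- The decomposition `g = k ⊕ p`, in the form `x = (x + σ x) / 2 + (x - σ x) / 2`. -/
theorem exists_add_of_involution [CharZero E] (hσ2 : ∀ x : g, σ (σ x) = x) (x : g) :
    ∃ a b : g, σ a = a ∧ σ b = -b ∧ x = a + b := by
  refine ⟨(2 : E)⁻¹ • (x + σ x), (2 : E)⁻¹ • (x - σ x), ?_, ?_, ?_⟩
  · rw [map_smul, map_add, hσ2, add_comm]
  · rw [map_smul, map_sub, hσ2, ← smul_neg, neg_sub]
  · rw [← smul_add, add_add_sub_cancel, ← two_smul E x, smul_smul,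
      inv_mul_cancel₀ two_ne_zero, one_smul]

theorem eq_zero_of_apply_eq_neg [CharZero E] {x : g} (h₁ : σ x = x) (h₂ : σ x = -x) : x = 0 := by
  have h : (2 : E) • x = 0 := by
    rw [two_smul]; nth_rewrite 1 [← h₁]; rw [h₂, neg_add_cancel]
  exact (smul_eq_zero.mp h).resolve_left two_ne_zero

/-- The fixed points of `σ` are orthogonal to its `-1`-eigenspace. -/
theorem killingForm_eq_zero_of_apply_eq_neg [CharZero E] [FiniteDimensional E g] {x y : g}
    (hx : σ x = x) (hy : σ y = -y) : killingForm E g x y = 0 := by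
  have h := LieAlgebra.killingForm_of_equiv_apply σ x y
  rw [hx, hy, map_neg] at h
  exact self_eq_neg.mp h.symm

/-- A vector orthogonal to the fixed points of `σ` lies in the `-1`-eigenspace. -/
theorem apply_eq_neg_of_orthogonal [CharZero E] [FiniteDimensional E g] [LieAlgebra.IsKilling E g]
    (hσ2 : ∀ x : g, σ (σ x) = x) {n : g} (hn : ∀ x, σ x = x → killingForm E g x n = 0) :
    σ n = -n := by
  obtain ⟨a, b, ha, hb, rfl⟩ := exists_add_of_involution hσ2 n
  suffices h : a = 0 by rw [h, zero_add, hb]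
  refine (LieAlgebra.IsKilling.killingForm_nondegenerate E g).1 a fun z => ?_
  obtain ⟨c, d, hc, hd, rfl⟩ := exists_add_of_involution hσ2 z
  have h := hn c hc
  rw [map_add, killingForm_eq_zero_of_apply_eq_neg hc hb, add_zero] at h
  rw [map_add, killingForm_eq_zero_of_apply_eq_neg ha hd, add_zero, LieModule.traceForm_comm, h]

/-- The orthogonal complement of a `k`-stable subspace is `k`-stable. -/
theorem lie_orthogonal {V : Submodule E g} {a n : g}
    (hV : ∀ x ∈ lieFixedPoints σ, ∀ v ∈ V, ⁅x, v⁆ ∈ V)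
    (ha : σ a = a) (hn : ∀ v ∈ V, killingForm E g v n = 0) :
    ∀ v ∈ V, killingForm E g v ⁅a, n⁆ = 0 := by
  intro v hv
  rw [← neg_eq_zero, ← LieModule.traceForm_apply_lie_apply']
  exact hn _ (hV a ha v hv)

/-- The trace of `σ ∘ ad x ∘ ad y` vanishes for `x`, `y` in the `-1`-eigenspace of `σ`, if the fixed
points of `σ` are semisimple: as `σ` anticommutes with `ad x`, twice this trace is the trace of
`σ ∘ ad ⁅x, y⁆`, and `z ↦ tr (σ ∘ ad z)` vanishes on brackets of fixed points. -/
theorem trace_involution_mul_ad_mul_ad [CharZero E]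
    [LieAlgebra.IsSemisimple E (lieFixedPoints σ)] {x y : g} (hx : σ x = -x) (hy : σ y = -y) :
    LinearMap.trace E g
      ((σ.toLinearEquiv : g →ₗ[E] g) * (LieAlgebra.ad E g x * LieAlgebra.ad E g y)) = 0 := by
  set s : Module.End E g := (σ.toLinearEquiv : g →ₗ[E] g)
  let f : lieFixedPoints σ →ₗ[E] E :=
    { toFun := fun z => LinearMap.trace E g (s * LieAlgebra.ad E g (z : g))
      map_add' := fun a b => by simp [mul_add]
      map_smul' := fun c a => by simp }
  have hf : ∀ a b : lieFixedPoints σ, f ⁅a, b⁆ = 0 := by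
    intro a b
    change LinearMap.trace E g (s * LieAlgebra.ad E g ⁅(a : g), (b : g)⁆) = 0
    have hc : s * LieAlgebra.ad E g (a : g) = LieAlgebra.ad E g (a : g) * s := by
      ext z
      have ha : σ (a : g) = a := a.2
      change σ ⁅(a : g), z⁆ = ⁅(a : g), σ z⁆
      rw [LieEquiv.map_lie, ha]
    rw [ad_lie_eq_mul_sub_mul, mul_sub, map_sub, ← mul_assoc, hc, mul_assoc,
      LinearMap.trace_mul_comm, mul_assoc, sub_self]
  have hxy : ⁅x, y⁆ ∈ lieFixedPoints σ := by
    rw [mem_lieFixedPoints, LieEquiv.map_lie, hx, hy, lie_neg, neg_lie, neg_neg]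
  have h : LinearMap.trace E g (s * LieAlgebra.ad E g ⁅x, y⁆) = 0 :=
    LieAlgebra.IsSemisimple.linearMap_eq_zero f hf ⟨_, hxy⟩
  have hc : s * LieAlgebra.ad E g x = -(LieAlgebra.ad E g x * s) := by
    ext z
    change σ ⁅x, z⁆ = -⁅x, σ z⁆
    rw [LieEquiv.map_lie, hx, neg_lie]
  have h' : LinearMap.trace E g (s * (LieAlgebra.ad E g x * LieAlgebra.ad E g y)) =
      -LinearMap.trace E g (s * (LieAlgebra.ad E g y * LieAlgebra.ad E g x)) := by
    rw [← mul_assoc, hc, neg_mul, map_neg, mul_assoc, LinearMap.trace_mul_comm, mul_assoc]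
  rw [ad_lie_eq_mul_sub_mul, mul_sub, map_sub] at h
  rw [sub_eq_zero.mp h, ← self_eq_neg, ← h', sub_eq_zero.mp h]

/-! ### Stable subspaces containing the fixed points -/

variable [CharZero E] [FiniteDimensional E g] {V : Submodule E g}

/-- `⁅V ∩ p, N⁆ = 0` for a `k`-stable subspace `V ⊇ k`, where `N` is the orthogonal complement of
`V`. -/
theorem lie_eq_zero_of_mem_of_orthogonal [LieAlgebra.IsKilling E g]
    (hσ2 : ∀ x : g, σ (σ x) = x)
    (hV : ∀ x ∈ lieFixedPoints σ, ∀ v ∈ V, ⁅x, v⁆ ∈ V) (hkV : (lieFixedPoints σ).toSubmodule ≤ V)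
    {w n : g} (hw : w ∈ V) (hσw : σ w = -w) (hn : ∀ v ∈ V, killingForm E g v n = 0) :
    ⁅w, n⁆ = 0 := by
  have hσn : σ n = -n := apply_eq_neg_of_orthogonal hσ2 fun x hx => hn x (hkV hx)
  have hσ : σ ⁅w, n⁆ = ⁅w, n⁆ := by rw [LieEquiv.map_lie, hσw, hσn, lie_neg, neg_lie, neg_neg]
  refine eq_zero_of_apply_eq_neg hσ (apply_eq_neg_of_orthogonal hσ2 fun x hx => ?_)
  rw [← LieModule.traceForm_apply_lie_apply]
  exact hn _ (hV x hx w hw)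

/-- The orthogonal complement of a `k`-stable subspace `V ⊇ k` meets `V` trivially. -/
theorem eq_zero_of_mem_of_mem_orthogonal [LieAlgebra.IsKilling E g]
    [LieAlgebra.IsSemisimple E (lieFixedPoints σ)] (hσ2 : ∀ x : g, σ (σ x) = x)
    (hV : ∀ x ∈ lieFixedPoints σ, ∀ v ∈ V, ⁅x, v⁆ ∈ V) (hkV : (lieFixedPoints σ).toSubmodule ≤ V)
    {x : g} (hxV : x ∈ V) (hxN : ∀ v ∈ V, killingForm E g v x = 0) : x = 0 := by
  let U : LieSubmodule E (lieFixedPoints σ) g :=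
    { __ := V ⊓ (killingForm E g).orthogonal V
      lie_mem := fun {a m} hm =>
        ⟨hV a a.2 m hm.1, lie_orthogonal hV a.2 hm.2⟩ }
  have hU : ∀ {u : g}, u ∈ U ↔ u ∈ V ∧ ∀ v ∈ V, killingForm E g v u = 0 := Iff.rfl
  have hUneg : ∀ {u : g}, u ∈ U → σ u = -u := fun hu =>
    apply_eq_neg_of_orthogonal hσ2 fun z hz => (hU.mp hu).2 z (hkV hz)
  have hxU : x ∈ U := ⟨hxV, hxN⟩
  have hx : σ x = -x := hUneg hxU
  refine (LieAlgebra.IsKilling.killingForm_nondegenerate E g).1 x fun z => ?_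
  obtain ⟨c, y, hc, hy, rfl⟩ := exists_add_of_involution hσ2 z
  rw [map_add, LieModule.traceForm_comm, killingForm_eq_zero_of_apply_eq_neg hc hx, zero_add,
    killingForm_apply_apply]
  have hxy : ⁅x, y⁆ ∈ lieFixedPoints σ := by
    rw [mem_lieFixedPoints, LieEquiv.map_lie, hx, hy, lie_neg, neg_lie, neg_neg]
  set s : Module.End E g := (σ.toLinearEquiv : g →ₗ[E] g)
  set T : Module.End E g := (1 - s) * (LieAlgebra.ad E g x * LieAlgebra.ad E g y) with hT
  have hTa : ∀ z, T z = ⁅x, ⁅y, z⁆⁆ - σ ⁅x, ⁅y, z⁆⁆ := fun _ => rfl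
  have htr : LinearMap.trace E g (LieAlgebra.ad E g x ∘ₗ LieAlgebra.ad E g y) =
      LinearMap.trace E g T := by
    rw [hT, sub_mul, one_mul, map_sub, trace_involution_mul_ad_mul_ad hx hy, sub_zero]
    rfl
  -- `T` kills `k`, and on `p` it is `2 • (ad x ∘ ad y)`, with values in `⁅x, k⁆ ⊆ U`.
  have hrange : ∀ z, T z ∈ U.toSubmodule := by
    intro z
    obtain ⟨a, b, ha, hb, rfl⟩ := exists_add_of_involution hσ2 z
    have h₁ : T a = 0 := by
      rw [hTa, LieEquiv.map_lie, LieEquiv.map_lie, hx, hy, ha, neg_lie y, lie_neg, neg_lie, neg_neg,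
        sub_self]
    have hyb : ⁅y, b⁆ ∈ lieFixedPoints σ := by
      rw [mem_lieFixedPoints, LieEquiv.map_lie, hy, hb, lie_neg, neg_lie, neg_neg]
    have h₂ : ⁅x, ⁅y, b⁆⁆ ∈ U := by
      rw [← lie_skew]
      exact U.neg_mem (U.lie_mem (x := ⟨_, hyb⟩) hxU)
    rw [map_add, h₁, zero_add, hTa]
    refine U.sub_mem h₂ ?_
    rw [hUneg h₂]
    exact U.neg_mem h₂
  have hres : T.restrict (fun z _ => hrange z) =
      (2 : E) • LieModule.toEnd E (lieFixedPoints σ) U ⟨_, hxy⟩ := by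
    ext ⟨u, hu⟩
    have hxu : ⁅x, u⁆ = 0 := lie_eq_zero_of_mem_of_orthogonal hσ2 hV hkV hxV hx (hU.mp hu).2
    have h₁ : ⁅⁅x, y⁆, u⁆ = ⁅x, ⁅y, u⁆⁆ := by rw [leibniz_lie x y u, hxu, lie_zero, add_zero]
    have h₂ : ⁅⁅x, y⁆, u⁆ ∈ U := U.lie_mem (x := ⟨_, hxy⟩) hu
    change T u = (2 : E) • ⁅⁅x, y⁆, u⁆
    rw [hTa, ← h₁, hUneg h₂, sub_neg_eq_add, two_smul]
  let f : lieFixedPoints σ →ₗ[E] E :=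
    { toFun := fun z => LinearMap.trace E U (LieModule.toEnd E (lieFixedPoints σ) U z)
      map_add' := fun a b => by simp
      map_smul' := fun c a => by simp }
  have hf : f ⟨_, hxy⟩ = 0 :=
    LieAlgebra.IsSemisimple.linearMap_eq_zero f (fun a b => by simp [f]) _
  rw [htr, ← T.trace_restrict_eq_of_forall_mem U.toSubmodule hrange, hres, map_smul]
  exact smul_eq_zero_of_right _ hf

/-- If `g = V ⊕ N` for the orthogonal complement `N` of `V`, then `N + ⁅N, N⁆` is an ideal of `g`,
and it is orthogonal to `V ∩ p`. -/
theorem exists_lieIdeal_of_orthogonal [LieAlgebra.IsKilling E g] (hσ2 : ∀ x : g, σ (σ x) = x)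
    (hV : ∀ x ∈ lieFixedPoints σ, ∀ v ∈ V, ⁅x, v⁆ ∈ V) (hkV : (lieFixedPoints σ).toSubmodule ≤ V)
    (hcompl : IsCompl V ((killingForm E g).orthogonal V)) :
    ∃ I : LieIdeal E g, (∀ n, (∀ v ∈ V, killingForm E g v n = 0) → n ∈ I) ∧
      ∀ w ∈ V, σ w = -w → ∀ z ∈ I, killingForm E g w z = 0 := by
  set N := (killingForm E g).orthogonal V
  have hNmem : ∀ {n : g}, n ∈ N ↔ ∀ v ∈ V, killingForm E g v n = 0 := Iff.rfl
  have hNneg : ∀ {n : g}, n ∈ N → σ n = -n := fun hn =>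
    apply_eq_neg_of_orthogonal hσ2 fun z hz => hNmem.mp hn z (hkV hz)
  have hkN : ∀ {a n : g}, σ a = a → n ∈ N → ⁅a, n⁆ ∈ N := fun ha hn => lie_orthogonal hV ha hn
  have hWN : ∀ {w n : g}, w ∈ V → σ w = -w → n ∈ N → ⁅w, n⁆ = 0 := fun hw hσw hn =>
    lie_eq_zero_of_mem_of_orthogonal hσ2 hV hkV hw hσw hn
  have hNN : ∀ {m n : g}, m ∈ N → n ∈ N → σ ⁅m, n⁆ = ⁅m, n⁆ := fun hm hn => by
    rw [LieEquiv.map_lie, hNneg hm, hNneg hn, lie_neg, neg_lie, neg_neg]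
  set S : Set g := {z | z ∈ N ∨ ∃ m ∈ N, ∃ n ∈ N, z = ⁅m, n⁆}
  have hNS : ∀ {n : g}, n ∈ N → n ∈ Submodule.span E S := fun hn => Submodule.subset_span (Or.inl hn)
  have hNNS : ∀ {m n : g}, m ∈ N → n ∈ N → ⁅m, n⁆ ∈ Submodule.span E S := fun hm hn =>
    Submodule.subset_span (Or.inr ⟨_, hm, _, hn, rfl⟩)
  -- By `g = k + V ∩ p + N`, stability is checked on each of the three summands.
  have hstable : ∀ x : g, ∀ z ∈ S, ⁅x, z⁆ ∈ Submodule.span E S := by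
    intro x z hz
    obtain ⟨v, n, hv, hn, rfl⟩ : ∃ v n, v ∈ V ∧ n ∈ N ∧ v + n = x := by
      have hx : x ∈ V ⊔ N := by rw [hcompl.sup_eq_top]; exact Submodule.mem_top
      obtain ⟨v, hv, n, hn, h⟩ := Submodule.mem_sup.mp hx
      exact ⟨v, n, hv, hn, h⟩
    obtain ⟨a, w, ha, hσw, rfl⟩ := exists_add_of_involution hσ2 v
    have hw : w ∈ V := by
      have := V.sub_mem hv (hkV (show a ∈ (lieFixedPoints σ).toSubmodule from ha))
      rwa [add_sub_cancel_left] at this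
    rw [add_lie, add_lie]
    rcases hz with hz | ⟨m, hm, m', hm', rfl⟩
    · rw [hWN hw hσw hz, add_zero]
      exact add_mem (hNS (hkN ha hz)) (hNNS hn hz)
    · refine add_mem (add_mem ?_ ?_) ?_
      · rw [leibniz_lie]
        exact add_mem (hNNS (hkN ha hm) hm') (hNNS hm (hkN ha hm'))
      · rw [leibniz_lie, hWN hw hσw hm, hWN hw hσw hm', zero_lie, lie_zero, add_zero]
        exact zero_mem _
      · rw [← lie_skew]
        exact neg_mem (hNS (hkN (hNN hm hm') hn))
  refine ⟨{ __ := Submodule.span E S, lie_mem := fun {x m} hm => ?_ }, fun n hn => hNS hn,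
    fun w hw hσw z hz => ?_⟩
  · change m ∈ Submodule.span E S at hm
    change ⁅x, m⁆ ∈ Submodule.span E S
    induction hm using Submodule.span_induction with
    | mem z hz => exact hstable x z hz
    | zero => rw [lie_zero]; exact zero_mem _
    | add a b _ _ ha hb => rw [lie_add]; exact add_mem ha hb
    | smul c a _ ha => rw [lie_smul]; exact Submodule.smul_mem _ c ha
  · change z ∈ Submodule.span E S at hz
    induction hz using Submodule.span_induction with
    | mem z hz =>
      rcases hz with hz | ⟨m, hm, m', hm', rfl⟩
      · exact hNmem.mp hz w hw
      · rw [← LieModule.traceForm_apply_lie_apply, hWN hw hσw hm, map_zero, LinearMap.zero_apply]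
    | zero => rw [map_zero]
    | add a b _ _ ha hb => rw [map_add, ha, hb, add_zero]
    | smul c a _ ha => rw [map_smul, ha, smul_zero]

theorem eq_lieFixedPoints_or_eq_top_of_isKilling [LieAlgebra.IsKilling E g]
    [LieAlgebra.IsSemisimple E (lieFixedPoints σ)] (hg : LieModule.IsIrreducible E g g)
    (hσ2 : ∀ x : g, σ (σ x) = x)
    (hV : ∀ x ∈ lieFixedPoints σ, ∀ v ∈ V, ⁅x, v⁆ ∈ V)
    (hkV : (lieFixedPoints σ).toSubmodule ≤ V) :
    V = (lieFixedPoints σ).toSubmodule ∨ V = ⊤ := by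
  have hcompl : IsCompl V ((killingForm E g).orthogonal V) := by
    rw [LinearMap.BilinForm.isCompl_orthogonal_iff_disjoint
      (LieModule.traceForm_isSymm E g g).isRefl, Submodule.disjoint_def]
    exact fun x hx hx' => eq_zero_of_mem_of_mem_orthogonal hσ2 hV hkV hx hx'
  obtain ⟨I, hI₁, hI₂⟩ := exists_lieIdeal_of_orthogonal hσ2 hV hkV hcompl
  rcases hg.eq_bot_or_eq_top I with rfl | rfl
  · right
    have hbot : (killingForm E g).orthogonal V = ⊥ :=
      (Submodule.eq_bot_iff _).mpr fun n hn => (LieSubmodule.mem_bot n).mp (hI₁ n hn)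
    have htop := hcompl.sup_eq_top
    rwa [hbot, sup_bot_eq] at htop
  · left
    refine le_antisymm (fun v hv => ?_) hkV
    obtain ⟨a, w, ha, hσw, rfl⟩ := exists_add_of_involution hσ2 v
    have hw : w ∈ V := by
      have := V.sub_mem hv (hkV (show a ∈ (lieFixedPoints σ).toSubmodule from ha))
      rwa [add_sub_cancel_left] at this
    have hw0 : w = 0 := (LieAlgebra.IsKilling.killingForm_nondegenerate E g).1 w fun z =>
      hI₂ w hw hσw z (LieSubmodule.mem_top z)
    rw [hw0, add_zero]
    exact ha

end Involution

/- A Lie algebra is called simple here if it is nonzero and its only ideals are `⊥` and `⊤`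
(that is, it is irreducible under its adjoint representation); the one-dimensional Lie algebra
is included, so this is weaker than `LieAlgebra.IsSimple`. -/
theorem mainTheorem4 {E : Type*} {g : Type*} [Field E] [CharZero E]
    [LieRing g] [LieAlgebra E g] [FiniteDimensional E g]
    (hg : LieModule.IsIrreducible E g g)
    (σ : g ≃ₗ⁅E⁆ g) (hσ : σ ≠ LieEquiv.refl) (hσ2 : ∀ x : g, σ (σ x) = x)
    (hk : LieAlgebra.IsSemisimple E (lieFixedPoints σ)) :
    (∀ V : Submodule E g,
      (∀ x ∈ lieFixedPoints σ, ∀ v ∈ V, ⁅x, v⁆ ∈ V) →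
      (lieFixedPoints σ).toSubmodule ≤ V →
        V = (lieFixedPoints σ).toSubmodule ∨ V = ⊤) ∧
    IsCoatom (lieFixedPoints σ) := by
  have hne : (lieFixedPoints σ).toSubmodule ≠ ⊤ := fun h => hσ <| DFunLike.ext _ _ fun x =>
    mem_lieFixedPoints.mp <| show x ∈ (lieFixedPoints σ).toSubmodule from
      h ▸ Submodule.mem_top
  have main : ∀ V : Submodule E g,
      (∀ x ∈ lieFixedPoints σ, ∀ v ∈ V, ⁅x, v⁆ ∈ V) →
      (lieFixedPoints σ).toSubmodule ≤ V →
        V = (lieFixedPoints σ).toSubmodule ∨ V = ⊤ := by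
    intro V hV hkV
    by_cases hab : IsLieAbelian g
    · -- Every subspace of an abelian Lie algebra is an ideal.
      let I : LieIdeal E g :=
        { __ := V, lie_mem := fun {x m} _ => by rw [trivial_lie_zero]; exact V.zero_mem }
      rcases hg.eq_bot_or_eq_top I with h | h
      · left
        have hbot : V = ⊥ := congrArg LieSubmodule.toSubmodule h
        rw [hbot] at hkV ⊢
        exact (le_bot_iff.mp hkV).symm
      · exact Or.inr (congrArg LieSubmodule.toSubmodule h)
    · have : LieAlgebra.IsSimple E g := ⟨hg.eq_bot_or_eq_top, hab⟩
      exact eq_lieFixedPoints_or_eq_top_of_isKilling hg hσ2 hV hkV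
  refine ⟨main, fun h => hne (by rw [h]; rfl), fun L hL => ?_⟩
  have hle : lieFixedPoints σ ≤ L := hL.le
  rcases main L.toSubmodule (fun x hx v hv => L.lie_mem (hle hx) hv) hle with h | h
  · exact absurd (LieSubalgebra.toSubmodule_injective h).symm hL.ne
  · exact LieSubalgebra.toSubmodule_injective h
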